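/- Let $\alpha=(\alpha_n)_{n\ge 1}$ be a sequence in $(0,1)$. Put $C_0=[0,1]$ and, for $n\ge1$, let $C_n$ be obtained from $C_{n-1}$ by removing from each of the $2^{n-1}$ closed intervals $J$ that make up $C_{n-1}$ the open interval with the same midpoint as $J$ and length $\alpha_n|J|$. Let $C=\bigcap_{n}C_n$ be the resulting generalized Cantor set, $I=[0,1]\setminus C$, and let $$l_n=\frac{(1-\alpha_1)\cdots(1-\alpha_{n-1})\,\alpha_n}{2^{n-1}}$$ be the common length of the $2^{n-1}$ intervals removed at step $n$. For a Borel set $M\subset[0,1]$ let $K_M(x,y)=\widehat{\chi_M}(x-y)$, $x,y\in\mathbb R$, where $\widehat g(\xi)=\int_{\mathbb R}g(t)e^{-2\pi i t\xi}\,dt$. A point process on $\mathbb R$ is a Borel probability measure $\mathbb P$ on the space $\mathrm{Conf}(\mathbb R)$ of locally finite configurations $X=\sum_i\delta_{x_i}$ with the vague topology. It is determinantal with correlation kernel $K$ (with respect to Lebesgue measure) if $\mathbb P$-almost every configuration is simple and, for all $n\ge1$ and all bounded compactly supported measurable $\varphi:\mathbb R^n\to\mathbb C$, $$\mathbb E_{\mathbb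 P}\Big[\sum_{\substack{x_1,\dots,x_n\in X\\ \text{distinct}}}\varphi(x_1,\dots,x_n)\Big]=\int_{\mathbb R^n}\varphi(x_1,\dots,x_n)\det[K(x_i,x_j)]_{1\le i,j\le n}\,dx_1\cdots dx_n .$$ It is (Ghosh–Peres) number rigid if for every compact $B\subset\mathbb R$ the number of particles $\#_B(X)=X(B)$ is measurable with respect to the $\mathbb P$-completion of $\mathcal F_{\mathbb R\setminus B}=\sigma(\#_A: A\subset\mathbb R\setminus B\text{ Borel})$, i.e. with respect to the $\sigma$-algebra of all sets that agree with a set of $\mathcal F_{\mathbb R\setminus B}$ up to a $\mathbb P$-null set. **Theorem.** If there is $\delta\in(0,1)$ such that $$\sum_{n=1}^{\infty} l_n^{\,1/4^{n/\delta}}<\infty,$$ then the determinantal point process with correlation kernel $K_C$ and the determinantal point process with correlation kernel $K_I$ are both number rigid; that is, every point process on $\mathbb R$ that is determinantal with kernel $K_C$, or with kernel $K_I$, is number rigid. -/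

import Mathlib

open MeasureTheory Set
open scoped FourierTransform CompactlySupported ENNReal

noncomputable section

/-! ### Configurations and point processes -/

/-- `Conf E`: locally finite configurations `X = ∑ i, δ_{x i}` on `E`, as counting measures
(with multiplicities) that are finite on compact sets. -/
def Conf (E : Type*) [TopologicalSpace E] [MeasurableSpace E] : Type _ :=
  {X : Measure E // (∃ (ι : Type) (_ : Countable ι) (x : ι → E),
      X = Measure.sum fun i => Measure.dirac (x i)) ∧
    ∀ K : Set E, IsCompact K → X K < ∞}

namespace Conf

variable {E : Type*} [TopologicalSpace E] [MeasurableSpace E]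

/-- The vague topology: the weakest topology for which `X ↦ ∫ f dX` is continuous for every
compactly supported continuous `f`. -/
instance : TopologicalSpace (Conf E) :=
  ⨅ f : C_c(E, ℝ), TopologicalSpace.induced (fun X : Conf E => ∫ x, f x ∂X.1) inferInstance

/-- Point processes are probability measures on the Borel σ-algebra of the vague topology. -/
instance : MeasurableSpace (Conf E) := borel (Conf E)

instance : BorelSpace (Conf E) := ⟨rfl⟩

/-- The number of particles `#_B(X)` of the configuration `X` in `B`. -/
def count (B : Set E) (X : Conf E) : ℝ≥0∞ := X.1 B

/-- The set of points charged by the configuration. -/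
def points (X : Conf E) : Set E := {x | X.1 {x} ≠ 0}

/-- A configuration is simple if it has no multiple points. -/
def IsSimple (X : Conf E) : Prop := ∀ x, X.1 {x} ≤ 1

/-- `𝓕_S`: the σ-algebra generated by the `#_B`, `B` a Borel subset of `S`. -/
@[reducible] def sigmaAlgebra (S : Set E) : MeasurableSpace (Conf E) :=
  ⨆ (B : Set E) (_ : MeasurableSet B) (_ : B ⊆ S),
    MeasurableSpace.comap (count B) inferInstance

/-- The sum of `φ (x₁, …, xₙ)` over all `n`-tuples of distinct points of the configuration.
(For a compactly supported `φ` only finitely many terms are nonzero.) -/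
def tupleSum {n : ℕ} (φ : (Fin n → E) → ℂ) (X : Conf E) : ℂ :=
  ∑' x : Fin n ↪ X.points, φ fun i => (x i : E)

end Conf

/-- The point process `P` is determinantal with correlation kernel `K` with respect to the
reference measure `μ`: it is simple, and for every `n ≥ 1` and every bounded compactly supported
measurable `φ` on `Eⁿ` the expectation of the sum of `φ` over `n`-tuples of distinct particles is
the integral of `φ (x₁, …, xₙ) det [K (xᵢ, xⱼ)]` (both being well-defined). -/
structure IsDeterminantal {E : Type*} [TopologicalSpace E] [MeasurableSpace E]
    (K : E → E → ℂ) (μ : Measure E) (P : Measure (Conf E)) : Prop where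
  simple : ∀ᵐ X ∂P, X.IsSimple
  correlation : ∀ n : ℕ, 1 ≤ n → ∀ φ : (Fin n → E) → ℂ, Measurable φ → HasCompactSupport φ →
    (∃ M : ℝ, ∀ x, ‖φ x‖ ≤ M) →
    Integrable (Conf.tupleSum φ) P ∧
    Integrable (fun x : Fin n → E => φ x * (Matrix.of fun i j => K (x i) (x j)).det)
      (Measure.pi fun _ => μ) ∧
    ∫ X, Conf.tupleSum φ X ∂P =
      ∫ x : Fin n → E, φ x * (Matrix.of fun i j => K (x i) (x j)).det ∂(Measure.pi fun _ => μ)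

/-- Ghosh–Peres number rigidity: for every compact `B`, the number of particles in `B` is
measurable for the `P`-completion of `𝓕_{Bᶜ}`, i.e. the σ-algebra of all sets that agree with a
set of `𝓕_{Bᶜ}` up to a `P`-null set. -/
def IsNumberRigid {E : Type*} [TopologicalSpace E] [MeasurableSpace E]
    (P : Measure (Conf E)) : Prop :=
  ∀ B : Set E, IsCompact B →
    Measurable[eventuallyMeasurableSpace (Conf.sigmaAlgebra Bᶜ) (ae P)] (Conf.count B)

/-! ### Generalized Cantor sets

A sequence of ratios `α₁, α₂, …` is a function `α : ℕ → ℝ`, whose value at `0` is not used. -/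

/-- The two closed intervals that are left when the open middle `a`-th (same midpoint, length `a`
times the length) is removed from `[p.1, p.2]`; intervals are given by their endpoints. -/
def removeMiddle (a : ℝ) (p : ℝ × ℝ) : List (ℝ × ℝ) :=
  [(p.1, (p.1 + p.2) / 2 - a * (p.2 - p.1) / 2), ((p.1 + p.2) / 2 + a * (p.2 - p.1) / 2, p.2)]

/-- The `2 ^ n` closed intervals that make up the `n`-th stage `C_n` of the construction. -/
def cantorIntervals (α : ℕ → ℝ) : ℕ → List (ℝ × ℝ)
  | 0 => [(0, 1)]
  | n + 1 => (cantorIntervals α n).flatMap (removeMiddle (α (n + 1)))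

/-- The `n`-th stage `C_n`, with `C_0 = [0, 1]`. -/
def cantorStage (α : ℕ → ℝ) (n : ℕ) : Set ℝ := ⋃ p ∈ cantorIntervals α n, Icc p.1 p.2

/-- The generalized Cantor set `C = ⋂ C_n`. -/
def genCantorSet (α : ℕ → ℝ) : Set ℝ := ⋂ n, cantorStage α n

/-- `l_n = (1 - α₁) ⋯ (1 - α_{n-1}) α_n / 2 ^ (n - 1)` for `n ≥ 1`: the common length of the open
intervals removed at step `n`. -/
def gapLength (α : ℕ → ℝ) (n : ℕ) : ℝ := (∏ k ∈ Finset.Ico 1 n, (1 - α k)) * α n / 2 ^ (n - 1)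

/-- The translation-invariant kernel `K_M(x, y) = \hat{χ_M}(x - y)`, where
`\hat g (ξ) = ∫ g(x) e^{-2 π i x ξ} dx`. -/
def fourierKernel (M : Set ℝ) (x y : ℝ) : ℂ := 𝓕 (M.indicator fun _ => (1 : ℂ)) (x - y)

end

/-! By the Ghosh–Peres argument, rigidity on a compact set B follows from compactly supported test
functions f that equal 1 on B and whose linear statistics have variance tending to 0. Along a
subsequence the centred statistic tends to 0 almost surely, so the count in B is a limit of
quantities determined by the configuration outside B (`isNumberRigid_of_tendsto`).

For the kernel K_M, Fubini and Plancherel turn the variance into the integral of |M \ (M + u)| ·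
|f̂(u)|² (`integral_norm_sq_tupleSum_sub_le`). Against a weight of order |u| this is an H^{1/2}
norm, which can be made small although f = 1 on B: averaging m dyadic dilates of a bump gives |u|
|f̂(u)| ≲ 1/m with ∫ |f̂| bounded, at the price of |f̂| ≲ 2^m (`exists_bump_fourier_bounds`).

For the Cantor set the weight is at most 2^n |u| + |C_n \ C| for every n
(`translateDefect_genCantorSet_le`). Summability forces l_n ≤ 2^(-4^n) eventually, hence |C_n \ C| ≲
2^(-3^n) 2^(-n). The choice m = 3^n then gives a variance of order (2/3)^n + 2^(-n). Passing to the
complement I costs only one more |u|. -/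

namespace Conf

/-! ### Configurations and their linear statistics -/

section General

variable {E : Type*} [TopologicalSpace E] [MeasurableSpace E]

lemma tupleSum_one (g : E → ℂ) (X : Conf E) :
    tupleSum (fun x : Fin 1 → E => g (x 0)) X = ∑' p : X.points, g p :=
  (Equiv.uniqueEmbeddingEquivResult (α := Fin 1) (β := X.points)).tsum_eq
    (fun p : X.points => g p)

/-- Used with S = Bᶜ: the part of a linear statistic coming from outside B is known from outside B.
-/
lemma measurable_setLIntegral_sigmaAlgebra {S : Set E} (hS : MeasurableSet S) {f : E → ℝ≥0∞}
    (hf : Measurable f) :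
    Measurable[sigmaAlgebra S] fun X : Conf E => ∫⁻ y in S, f y ∂X.1 := by
  let _ : MeasurableSpace (Conf E) := sigmaAlgebra S
  have h : Measurable fun X : Conf E => X.1.restrict S := by
    refine Measure.measurable_of_measurable_coe _ fun s hs => ?_
    have : (fun X : Conf E => X.1.restrict S s) = count (s ∩ S) := by
      ext X
      exact Measure.restrict_apply hs
    rw [this]
    have hle : MeasurableSpace.comap (count (s ∩ S)) inferInstance ≤ sigmaAlgebra (E := E) S :=
      le_iSup_of_le (s ∩ S) (le_iSup_of_le (hs.inter hS) (le_iSup_of_le inter_subset_right le_rfl))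
    exact (comap_measurable (count (s ∩ S))).mono hle le_rfl
  exact (Measure.measurable_lintegral hf).comp h

variable [MeasurableSingletonClass E]

lemma one_le_of_mem_points {X : Conf E} {p : E} (hp : p ∈ X.points) : 1 ≤ X.1 {p} := by
  obtain ⟨⟨ι, _, x, hx⟩, -⟩ := X.2
  have hp' : X.1 {p} ≠ 0 := hp
  rw [hx, Measure.sum_apply _ (measurableSet_singleton p)] at hp' ⊢
  obtain ⟨i, hi⟩ : ∃ i, Measure.dirac (x i) {p} ≠ 0 := by
    by_contra! h
    exact hp' (by simp only [h, tsum_zero])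
  have h1 : Measure.dirac (x i) {p} = 1 := by
    rw [Measure.dirac_apply' _ (measurableSet_singleton p)] at hi ⊢
    by_cases hxi : x i ∈ ({p} : Set E)
    · simp [indicator_of_mem hxi]
    · exact absurd (indicator_of_notMem hxi _) hi
  exact h1.symm.le.trans (ENNReal.le_tsum i)

lemma finite_points_inter (X : Conf E) {K : Set E} (hK : IsCompact K) :
    (X.points ∩ K).Finite := by
  by_contra hinf
  have hlt := X.2.2 K hK
  obtain ⟨n, hn⟩ := ENNReal.exists_nat_gt hlt.ne
  obtain ⟨s, hs, hcard⟩ := Set.Infinite.exists_subset_card_eq hinf n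
  have h1 : (n : ℝ≥0∞) ≤ X.1 K := by
    calc (n : ℝ≥0∞) = ∑ _p ∈ s, (1 : ℝ≥0∞) := by simp [hcard]
      _ ≤ ∑ p ∈ s, X.1 {p} :=
        Finset.sum_le_sum fun p hp => one_le_of_mem_points (hs hp).1
      _ = X.1 s := sum_measure_singleton
      _ ≤ X.1 K := measure_mono fun p hp => (hs hp).2
  exact absurd hn h1.not_gt

/-- The integral of a function against a simple configuration is the sum over its points. -/
lemma lintegral_eq_tsum {X : Conf E} (hX : X.IsSimple) (f : E → ℝ≥0∞) :
    ∫⁻ y, f y ∂X.1 = ∑' p : X.points, f p := by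
  obtain ⟨⟨ι, _, x, hx⟩, -⟩ := X.2
  have hval : ∀ p, X.1 {p} = ∑' i, ({p} : Set E).indicator 1 (x i) := fun p => by
    rw [hx, Measure.sum_apply _ (measurableSet_singleton p)]
    simp only [Measure.dirac_apply' _ (measurableSet_singleton p)]
  have hinj : Function.Injective x := by
    intro i j hij
    classical
    by_contra hne
    have h2 : (2 : ℝ≥0∞) ≤ X.1 {x i} := by
      rw [hval]
      refine le_trans ?_ (ENNReal.sum_le_tsum ({i, j} : Finset ι))
      rw [Finset.sum_pair hne]
      simp [hij, one_add_one_eq_two]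
    exact absurd (h2.trans (hX (x i))) (by simp)
  have hrange : X.points = range x := by
    ext p
    simp only [points, mem_ofPred_eq, hval, ne_eq, ENNReal.tsum_eq_zero, not_forall, mem_range]
    refine exists_congr fun i => ?_
    by_cases h : x i = p <;> simp [h]
  calc ∫⁻ y, f y ∂X.1 = ∑' i, f (x i) := by
        rw [hx, lintegral_sum_measure]; simp
    _ = ∑' p : range x, f p := (tsum_range f hinj).symm
    _ = ∑' p : X.points, f p := by rw [hrange]

lemma finite_support_points (X : Conf E) {M : Type*} [Zero M] {f : E → M}
    (hf : HasCompactSupport f) : (Function.support fun p : X.points => f p).Finite := by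
  refine Set.Finite.of_finite_image ((X.finite_points_inter hf).subset ?_)
    Subtype.val_injective.injOn
  rintro _ ⟨p, hp, rfl⟩
  exact ⟨p.2, subset_tsupport f hp⟩

/-- Embeddings of `Fin 2` are the ordered pairs off the diagonal, so this is the square of a finite
sum split into diagonal and off-diagonal terms. It links second moments to the two-point
correlation. -/
lemma tsum_embedding_two {P : Type*} (g : P → ℂ) (hg : (Function.support g).Finite) :
    (∑' p, g p) ^ 2 = ∑' p, g p ^ 2 + ∑' e : Fin 2 ↪ P, g (e 0) * g (e 1) := by
  classical
  set T := hg.toFinset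
  have hT : ∀ p ∉ T, g p = 0 := fun p hp => by simpa [T] using hp
  let F : P × P → ℂ := fun q => if q.1 = q.2 then 0 else g q.1 * g q.2
  let j : (Fin 2 ↪ P) → P × P := fun e => (e 0, e 1)
  have hj : Function.Injective j := by
    intro e e' h
    simp only [j, Prod.mk.injEq] at h
    ext i
    fin_cases i
    · exact h.1
    · exact h.2
  have hsupp : Function.support F ⊆ range j := by
    rintro ⟨a, b⟩ hab
    have hne : a ≠ b := fun h => hab (by simp [F, h])
    refine ⟨⟨![a, b], ?_⟩, Prod.ext rfl rfl⟩
    intro u v huv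
    fin_cases u <;> fin_cases v <;> simp_all [eq_comm]
  have h2 : ∑' e : Fin 2 ↪ P, g (e 0) * g (e 1) = ∑ q ∈ T ×ˢ T, F q := by
    rw [← tsum_eq_sum (s := T ×ˢ T) (f := F) (L := .unconditional _), ← hj.tsum_eq hsupp]
    · refine tsum_congr fun e => ?_
      have : e 0 ≠ e 1 := fun h => by simpa using e.injective h
      simp [F, j, this]
    · rintro ⟨a, b⟩ hab
      rw [Finset.mem_product, not_and_or] at hab
      rcases hab with h | h <;> simp [F, hT _ h]
  rw [h2, tsum_eq_sum (s := T) hT, tsum_eq_sum (s := T) (fun p hp => by simp [hT p hp]),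
    Finset.sum_product, sq, Finset.sum_mul_sum, ← Finset.sum_add_distrib]
  refine Finset.sum_congr rfl fun a ha => ?_
  have : ∀ b, g a * g b = (if a = b then g a * g b else 0) + F (a, b) := fun b => by
    by_cases h : a = b <;> simp [F, h]
  rw [Finset.sum_congr rfl fun b _ => this b, Finset.sum_add_distrib, Finset.sum_ite_eq,
    if_pos ha, sq]

lemma tupleSum_one_sq (X : Conf E) {g : E → ℂ} (hg : HasCompactSupport g) :
    tupleSum (fun x : Fin 1 → E => g (x 0)) X ^ 2 =
      tupleSum (fun x : Fin 1 → E => g (x 0) ^ 2) X +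
        tupleSum (fun x : Fin 2 → E => g (x 0) * g (x 1)) X := by
  rw [tupleSum_one, tupleSum_one (fun y => g y ^ 2),
    tsum_embedding_two _ (X.finite_support_points hg)]
  rfl

/-- Because f = 1 on B, the statistic is the count in B plus an exterior part; the whole sum has
finitely many nonzero terms, so both parts are finite. -/
lemma tsum_points_eq_count_add {X : Conf E} (hX : X.IsSimple) {B : Set E}
    (hBm : MeasurableSet B) {f : E → ℝ} (hf0 : 0 ≤ f) (hfc : HasCompactSupport f)
    (hfB : ∀ x ∈ B, f x = 1) :
    X.count B ≠ ∞ ∧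
    tupleSum (fun x : Fin 1 → E => (f (x 0) : ℂ)) X =
      (((X.count B).toReal + (∫⁻ y in Bᶜ, ENNReal.ofReal (f y) ∂X.1).toReal : ℝ) : ℂ) := by
  have hsum : ∫⁻ y, ENNReal.ofReal (f y) ∂X.1 = ∑' p : X.points, ENNReal.ofReal (f p) :=
    lintegral_eq_tsum hX _
  have hsplit : ∫⁻ y, ENNReal.ofReal (f y) ∂X.1 =
      X.count B + ∫⁻ y in Bᶜ, ENNReal.ofReal (f y) ∂X.1 := by
    rw [← lintegral_add_compl _ hBm, setLIntegral_congr_fun hBm (g := fun _ => 1)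
      (fun x hx => by simp [hfB x hx])]
    simp [count]
  have hfin : ∫⁻ y, ENNReal.ofReal (f y) ∂X.1 ≠ ∞ := by
    have hs := X.finite_support_points hfc
    rw [hsum, tsum_eq_sum (s := hs.toFinset) (fun p hp => by
      have : f p = 0 := by simpa using hp
      simp [this])]
    exact ENNReal.sum_ne_top.2 fun _ _ => ENNReal.ofReal_ne_top
  rw [hsplit] at hfin
  obtain ⟨h1, h2⟩ := ENNReal.add_ne_top.1 hfin
  refine ⟨h1, ?_⟩
  rw [tupleSum_one (fun y => (f y : ℂ)), ← Complex.ofReal_tsum, ← ENNReal.toReal_add h1 h2,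
    ← hsplit, hsum, ENNReal.tsum_toReal_eq fun _ => ENNReal.ofReal_ne_top]
  simp [ENNReal.toReal_ofReal (hf0 _)]

end General

end Conf

/-! ### The Ghosh–Peres criterion -/

open Filter Topology in
/-- Number rigidity follows from the almost sure asymptotic degeneracy of linear statistics whose
test functions equal `1` on the given compact set. -/
theorem isNumberRigid_of_tendsto {P : Measure (Conf ℝ)} (hs : ∀ᵐ X ∂P, X.IsSimple)
    (h : ∀ B : Set ℝ, IsCompact B → ∃ (f : ℕ → ℝ → ℝ) (c : ℕ → ℝ),
      (∀ n, Measurable (f n) ∧ 0 ≤ f n ∧ HasCompactSupport (f n) ∧ ∀ x ∈ B, f n x = 1) ∧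
      ∀ᵐ X ∂P, Tendsto
        (fun n => Conf.tupleSum (fun x : Fin 1 → ℝ => (f n (x 0) : ℂ)) X - c n) atTop (𝓝 0)) :
    IsNumberRigid P := by
  intro B hB
  obtain ⟨f, c, hf, hlim⟩ := h B hB
  have hBm := hB.measurableSet
  -- The candidate for the count: mean minus exterior part. A limsup is measurable without knowing
  -- convergence. Truncation at 0 by `ENNReal.ofReal` is harmless, since the almost sure limit is a
  -- count.
  let G : Conf ℝ → ℝ≥0∞ := fun X => limsup (fun n =>
    ENNReal.ofReal (c n - (∫⁻ y in Bᶜ, ENNReal.ofReal (f n y) ∂X.1).toReal)) atTop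
  have hG : Measurable[Conf.sigmaAlgebra Bᶜ] G := by
    let _ : MeasurableSpace (Conf ℝ) := Conf.sigmaAlgebra Bᶜ
    refine Measurable.limsup fun n => ?_
    exact (measurable_const.sub (Conf.measurable_setLIntegral_sigmaAlgebra hBm.compl
      (hf n).1.ennreal_ofReal).ennreal_toReal).ennreal_ofReal
  refine Measurable.eventuallyMeasurable_of_eventuallyEq hG ?_
  filter_upwards [hs, hlim] with X hX hXlim
  have key := fun n => Conf.tsum_points_eq_count_add hX hBm (hf n).2.1 (hf n).2.2.1 (hf n).2.2.2
  have h1 : Tendsto (fun n => (X.count B).toReal -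
      (Conf.tupleSum (fun x : Fin 1 → ℝ => (f n (x 0) : ℂ)) X - c n).re) atTop
      (𝓝 ((X.count B).toReal - 0)) :=
    tendsto_const_nhds.sub ((Complex.continuous_re.tendsto 0).comp hXlim)
  have h2 := (ENNReal.continuous_ofReal.tendsto _).comp h1
  rw [sub_zero, ENNReal.ofReal_toReal (key 0).1] at h2
  rw [← h2.limsup_eq]
  refine limsup_congr (Eventually.of_forall fun n => ?_)
  simp only [Function.comp, (key n).2, ← Complex.ofReal_sub, Complex.ofReal_re]
  congr 1
  ring

/-! ### Variance of linear statistics -/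

/-- The character `t ↦ e^{-2πit}`. -/
noncomputable def expChar (t : ℝ) : ℂ := Complex.exp (((-2 * Real.pi * t : ℝ) : ℂ) * Complex.I)

lemma expChar_add (a b : ℝ) : expChar (a + b) = expChar a * expChar b := by
  rw [expChar, expChar, expChar, ← Complex.exp_add]
  congr 1
  push_cast
  ring

lemma norm_expChar (a : ℝ) : ‖expChar a‖ = 1 := Complex.norm_exp_ofReal_mul_I _

@[fun_prop]
lemma continuous_expChar : Continuous expChar := by
  unfold expChar
  fun_prop

lemma conj_expChar (a : ℝ) : (starRingEnd ℂ) (expChar a) = expChar (-a) := by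
  rw [expChar, expChar, ← Complex.exp_conj]
  congr 1
  simp only [map_mul, Complex.conj_ofReal, Complex.conj_I]
  push_cast
  ring

lemma fourier_eq_integral_expChar (f : ℝ → ℂ) (w : ℝ) :
    𝓕 f w = ∫ v, f v * expChar (v * w) := by
  rw [Real.fourier_real_eq_integral_exp_smul]
  refine integral_congr_ae (Filter.Eventually.of_forall fun v => ?_)
  simp only [smul_eq_mul, expChar, mul_comm (f v), mul_assoc]

lemma fourier_neg_of_real (g : ℝ → ℝ) (u : ℝ) :
    𝓕 (fun x => (g x : ℂ)) (-u) = (starRingEnd ℂ) (𝓕 (fun x => (g x : ℂ)) u) := by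
  rw [fourier_eq_integral_expChar, fourier_eq_integral_expChar, ← integral_conj]
  refine integral_congr_ae (Filter.Eventually.of_forall fun v => ?_)
  simp [conj_expChar]

section Variance

variable {M : Set ℝ}

lemma integrable_indicator_one (hM : MeasurableSet M) (hfin : volume M ≠ ∞) :
    Integrable (M.indicator fun _ => (1 : ℂ)) :=
  (integrable_indicator_iff hM).2 (integrableOn_const hfin)

lemma fourierKernel_self (hM : MeasurableSet M) (x : ℝ) :
    fourierKernel M x x = (volume.real M : ℂ) := by
  rw [fourierKernel, fourier_eq_integral_expChar]
  have : ∀ v : ℝ, expChar (v * (x - x)) = 1 := fun v => by simp [expChar]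
  simp only [this, mul_one]
  rw [integral_indicator hM]
  simp

/-- The two-point part of the variance, in the space and in the frequency variables. -/
lemma integral_mul_fourierKernel (hM : MeasurableSet M) (hfin : volume M ≠ ∞) {f : ℝ → ℂ}
    (hf : Integrable f) :
    Integrable (fun z : ℝ × ℝ => f z.1 * f z.2 *
      (fourierKernel M z.1 z.2 * fourierKernel M z.2 z.1)) (volume.prod volume) ∧
    ∫ z : ℝ × ℝ, f z.1 * f z.2 * (fourierKernel M z.1 z.2 * fourierKernel M z.2 z.1)
      ∂(volume.prod volume) =
    ∫ w : ℝ × ℝ, (M.indicator (fun _ => (1 : ℂ)) w.1 * M.indicator (fun _ => (1 : ℂ)) w.2) *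
      (𝓕 f (w.1 - w.2) * 𝓕 f (w.2 - w.1)) ∂(volume.prod volume) := by
  set χ : ℝ → ℂ := M.indicator fun _ => (1 : ℂ) with hχ
  have hχi : Integrable χ := integrable_indicator_one hM hfin
  -- Both sides are iterated integrals of this function of two space and two frequency variables,
  -- which is integrable because the phases are unimodular.
  let H : (ℝ × ℝ) × (ℝ × ℝ) → ℂ := fun q => ((f q.1.1 * f q.1.2) * (χ q.2.1 * χ q.2.2)) *
    (expChar (q.2.1 * (q.1.1 - q.1.2)) * expChar (q.2.2 * (q.1.2 - q.1.1)))
  have hH : Integrable H ((volume.prod volume).prod (volume.prod volume)) := by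
    refine ((hf.mul_prod hf).mul_prod (hχi.mul_prod hχi)).mul_bdd (c := 1) ?_ ?_
    · exact Continuous.aestronglyMeasurable (by fun_prop)
    · exact Filter.Eventually.of_forall fun q => by simp [norm_expChar]
  have h1 : ∀ z : ℝ × ℝ, ∫ w, H (z, w) ∂(volume.prod volume) =
      f z.1 * f z.2 * (fourierKernel M z.1 z.2 * fourierKernel M z.2 z.1) := fun z => by
    rw [fourierKernel, fourierKernel, fourier_eq_integral_expChar, fourier_eq_integral_expChar,
      ← integral_prod_mul, ← integral_const_mul]
    refine integral_congr_ae (Filter.Eventually.of_forall fun w => ?_)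
    simp only [H]
    ring
  have h2 : ∀ w : ℝ × ℝ, ∫ z, H (z, w) ∂(volume.prod volume) =
      (χ w.1 * χ w.2) * (𝓕 f (w.1 - w.2) * 𝓕 f (w.2 - w.1)) := fun w => by
    rw [fourier_eq_integral_expChar, fourier_eq_integral_expChar,
      ← integral_prod_mul, ← integral_const_mul]
    refine integral_congr_ae (Filter.Eventually.of_forall fun z => ?_)
    -- The phase s(x - y) + t(y - x) is regrouped as x(s - t) + y(t - s).
    have : expChar (w.1 * (z.1 - z.2)) * expChar (w.2 * (z.2 - z.1)) =
        expChar (z.1 * (w.1 - w.2)) * expChar (z.2 * (w.2 - w.1)) := by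
      rw [← expChar_add, ← expChar_add]
      congr 1
      ring
    simp only [H, this]
    ring
  simp only [← h1, ← h2]
  exact ⟨hH.integral_prod_left, integral_integral_swap hH⟩

/-- `|M| ∫ W - ∫_{M × M} W (s - t)` is the integral of `W` against the size of
`M \ (M + u)`. -/
lemma measureReal_mul_integral_sub (hM : MeasurableSet M) (hfin : volume M ≠ ∞) {W : ℝ → ℝ}
    (hW : Integrable W) :
    volume.real M * (∫ u, W u) - ∫ w : ℝ × ℝ, (M.indicator (fun _ => (1 : ℝ)) w.1 *
      M.indicator (fun _ => (1 : ℝ)) w.2) * W (w.1 - w.2) ∂(volume.prod volume) =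
    ∫ u, volume.real (M ∩ (fun s => s - u) ⁻¹' Mᶜ) * W u := by
  set χ : ℝ → ℝ := M.indicator fun _ => (1 : ℝ) with hχ
  have hχm : Measurable χ := measurable_const.indicator hM
  have hχ0 : ∀ s, 0 ≤ χ s := fun s => indicator_nonneg (fun _ _ => zero_le_one) s
  have hχ1 : ∀ s, χ s ≤ 1 := fun s => indicator_le' (fun _ _ => le_rfl) (fun _ _ => zero_le_one) s
  have hχi : Integrable χ := (integrable_indicator_iff hM).2 (integrableOn_const hfin)
  have hχint : ∫ s, χ s = volume.real M := by
    rw [hχ, integral_indicator hM]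
    simp
  have hbase : Integrable (fun q : ℝ × ℝ => χ q.1 * W q.2) (volume.prod volume) :=
    hχi.mul_prod hW
  have hsub : Measurable fun q : ℝ × ℝ => χ (q.1 - q.2) :=
    hχm.comp (measurable_fst.sub measurable_snd)
  have hA : Integrable (fun q : ℝ × ℝ => χ q.1 * W q.2 * χ (q.1 - q.2)) (volume.prod volume) := by
    refine hbase.mul_bdd (c := 1) hsub.aestronglyMeasurable (Filter.Eventually.of_forall fun q => ?_)
    rw [Real.norm_of_nonneg (hχ0 _)]
    exact hχ1 _
  have hinv : ∫ w : ℝ × ℝ, (χ w.1 * χ w.2) * W (w.1 - w.2) ∂(volume.prod volume) =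
      ∫ q : ℝ × ℝ, χ q.1 * W q.2 * χ (q.1 - q.2) ∂(volume.prod volume) := by
    -- The shear (s, t) ↦ (s, s - t) is a measure-preserving involution; it makes u = s - t a
    -- coordinate.
    let e : ℝ × ℝ ≃ᵐ ℝ × ℝ :=
      { toFun := fun q => (q.1, q.1 - q.2)
        invFun := fun q => (q.1, q.1 - q.2)
        left_inv := fun q => by simp
        right_inv := fun q => by simp
        measurable_toFun := measurable_fst.prodMk (measurable_fst.sub measurable_snd)
        measurable_invFun := measurable_fst.prodMk (measurable_fst.sub measurable_snd) }
    have he : MeasurePreserving e (volume.prod volume) (volume.prod volume) :=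
      (MeasurePreserving.id volume).skew_product (measurable_fst.sub measurable_snd)
        (Filter.Eventually.of_forall fun s => (volume.measurePreserving_sub_left s).map_eq)
    rw [← he.integral_comp']
    refine integral_congr_ae (Filter.Eventually.of_forall fun q => ?_)
    simp only [e, MeasurableEquiv.coe_mk, Equiv.coe_fn_mk, sub_sub_cancel]
    ring
  have hBA : Integrable (fun q : ℝ × ℝ => χ q.1 * W q.2 - χ q.1 * W q.2 * χ (q.1 - q.2))
      (volume.prod volume) := hbase.sub hA
  rw [hinv, ← hχint, ← integral_prod_mul, ← integral_sub hbase hA, integral_prod_symm _ hBA]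
  refine integral_congr_ae (Filter.Eventually.of_forall fun u => ?_)
  have hset : MeasurableSet (M ∩ (fun s => s - u) ⁻¹' Mᶜ) :=
    hM.inter ((measurable_id.sub_const u) hM.compl)
  have : ∀ s, χ s * W u - χ s * W u * χ (s - u) =
      (M ∩ (fun s => s - u) ⁻¹' Mᶜ).indicator (fun _ => (1 : ℝ)) s * W u := fun s => by
    by_cases h1 : s ∈ M <;> by_cases h2 : s - u ∈ M <;> simp [hχ, h1, h2]
  simp only [this]
  rw [integral_mul_const, integral_indicator hset]
  simp

variable {P : Measure (Conf ℝ)}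

/-- The variance of a linear statistic is controlled by the Fourier transform of the test
function, weighted with the size of `M \ (M + u)`. -/
theorem integral_norm_sq_tupleSum_sub_le [IsProbabilityMeasure P] (hM : MeasurableSet M)
    (hfin : volume M ≠ ∞) (hP : IsDeterminantal (fourierKernel M) volume P) (g : ℝ → ℝ)
    (f : SchwartzMap ℝ ℂ) (hfg : ⇑f = fun x => (g x : ℂ)) (hf : HasCompactSupport f) {b : ℝ}
    (hb : ∀ u, volume.real (M ∩ (fun s => s - u) ⁻¹' Mᶜ) * ‖𝓕 (f : ℝ → ℂ) u‖ ≤ b) :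
    Integrable (fun X => ‖Conf.tupleSum (fun x : Fin 1 → ℝ => (g (x 0) : ℂ)) X -
      (volume.real M * ∫ x, g x : ℝ)‖ ^ 2) P ∧
    ∫ X, ‖Conf.tupleSum (fun x : Fin 1 → ℝ => (g (x 0) : ℂ)) X -
      (volume.real M * ∫ x, g x : ℝ)‖ ^ 2 ∂P ≤ b * ∫ u, ‖𝓕 (f : ℝ → ℂ) u‖ := by
  have hfg' : ∀ x, f x = (g x : ℂ) := fun x => congrFun hfg x
  simp only [← hfg']
  set S : Conf ℝ → ℂ := Conf.tupleSum fun x : Fin 1 → ℝ => f (x 0) with hS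
  set m : ℝ := volume.real M
  set a : ℝ := ∫ x, g x
  have hfc : Continuous f := f.continuous
  have hfi : Integrable (f : ℝ → ℂ) := f.integrable
  have hsq : HasCompactSupport fun x => f x ^ 2 :=
    hf.comp_left (g := fun z : ℂ => z ^ 2) (by simp)
  have ha : ∫ x, f x = (a : ℂ) := by
    simp only [hfg', a]
    exact integral_ofReal
  have bdd : ∀ h : ℝ → ℂ, Continuous h → HasCompactSupport h → ∃ C : ℝ, ∀ x, ‖h x‖ ≤ C :=
    fun h h1 h2 => h2.exists_bound_of_continuous h1
  -- The intensity K(x, x) is the constant |M|.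
  have one : ∀ h : ℝ → ℂ, Continuous h → HasCompactSupport h →
      Integrable (Conf.tupleSum fun x : Fin 1 → ℝ => h (x 0)) P ∧
      ∫ X, Conf.tupleSum (fun x : Fin 1 → ℝ => h (x 0)) X ∂P = m * ∫ x, h x := by
    intro h h1 h2
    obtain ⟨C, hC⟩ := bdd h h1 h2
    obtain ⟨i1, -, i3⟩ := hP.correlation 1 le_rfl (fun x => h (x 0))
      (h1.measurable.comp (measurable_pi_apply 0))
      (HasCompactSupport.intro (isCompact_univ_pi fun _ : Fin 1 => h2) fun x hx => by
        refine image_eq_zero_of_notMem_tsupport fun hx' => hx fun i _ => ?_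
        rwa [Subsingleton.elim i 0])
      ⟨C, fun x => hC _⟩
    refine ⟨i1, i3.trans ?_⟩
    simp only [Matrix.det_fin_one, Matrix.of_apply, fourierKernel_self hM]
    rw [← integral_const_mul,
      ← (measurePreserving_funUnique (volume : Measure ℝ) (Fin 1)).integral_comp']
    refine integral_congr_ae (Filter.Eventually.of_forall fun x => ?_)
    simp [MeasurableEquiv.funUnique, m, mul_comm]
  have hkk := integral_mul_fourierKernel hM hfin hfi
  have hff : Integrable (fun z : ℝ × ℝ => f z.1 * f z.2) (volume.prod volume) := hfi.mul_prod hfi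
  obtain ⟨C, hC⟩ := bdd f hfc hf
  obtain ⟨j1, -, j3⟩ := hP.correlation 2 one_le_two (fun x => f (x 0) * f (x 1))
    ((hfc.measurable.comp (measurable_pi_apply 0)).mul
      (hfc.measurable.comp (measurable_pi_apply 1)))
    (HasCompactSupport.intro (isCompact_univ_pi fun _ : Fin 2 => hf) fun x hx => by
      by_contra hne
      refine hx fun i _ => ?_
      by_contra hi
      have := image_eq_zero_of_notMem_tsupport hi
      fin_cases i <;> simp_all)
    ⟨C * C, fun x => by
      rw [norm_mul]
      exact mul_le_mul (hC _) (hC _) (norm_nonneg _) ((norm_nonneg _).trans (hC 0))⟩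
  -- Expansion of the 2 × 2 determinant: the diagonal product gives the squared mean, which cancels
  -- in the variance.
  have two : ∫ X, Conf.tupleSum (fun x : Fin 2 → ℝ => f (x 0) * f (x 1)) X ∂P =
      m ^ 2 * a ^ 2 - ∫ z : ℝ × ℝ, f z.1 * f z.2 *
        (fourierKernel M z.1 z.2 * fourierKernel M z.2 z.1) ∂(volume.prod volume) := by
    rw [j3, ← ha, sq (∫ x, f x), ← integral_prod_mul, ← integral_const_mul,
      ← integral_sub (hff.const_mul _) hkk.1,
      ← (measurePreserving_finTwoArrow (volume : Measure ℝ)).integral_comp']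
    refine integral_congr_ae (Filter.Eventually.of_forall fun x => ?_)
    simp only [Matrix.det_fin_two, Matrix.of_apply, fourierKernel_self hM,
      MeasurableEquiv.finTwoArrow, MeasurableEquiv.piFinTwo, MeasurableEquiv.coe_mk,
      piFinTwoEquiv_apply, m]
    ring
  obtain ⟨s1, s2⟩ := one f hfc hf
  obtain ⟨q1, q2⟩ := one (fun x => f x ^ 2) (hfc.pow 2) hsq
  have hSS : ∀ X, S X ^ 2 = Conf.tupleSum (fun x : Fin 1 → ℝ => f (x 0) ^ 2) X +
      Conf.tupleSum (fun x : Fin 2 → ℝ => f (x 0) * f (x 1)) X := fun X =>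
    Conf.tupleSum_one_sq X hf
  have hreal : ∀ X, ((‖S X - (m * a : ℝ)‖ ^ 2 : ℝ) : ℂ) =
      S X ^ 2 - 2 * (m * a) * S X + (m * a) ^ 2 := by
    intro X
    have : S X = ((∑' p : X.points, g p : ℝ) : ℂ) := by
      rw [hS, Conf.tupleSum_one]
      simp only [hfg']
      exact (Complex.ofReal_tsum _).symm
    rw [this, ← Complex.ofReal_sub, Complex.norm_real, Real.norm_eq_abs, sq_abs]
    push_cast
    ring
  have hSSi : Integrable (fun X => S X ^ 2) P := by
    simp only [hSS]
    exact q1.add j1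
  have hlin : Integrable (fun X => 2 * ((m : ℂ) * a) * S X) P := s1.const_mul _
  have hdiff : Integrable (fun X => S X ^ 2 - 2 * ((m : ℂ) * a) * S X) P := hSSi.sub hlin
  have hall : Integrable (fun X => S X ^ 2 - 2 * (m * a) * S X + ((m : ℂ) * a) ^ 2) P :=
    hdiff.add (integrable_const _)
  have hvar : ((∫ X, ‖S X - (m * a : ℝ)‖ ^ 2 ∂P : ℝ) : ℂ) = m * (∫ x, f x ^ 2) -
      ∫ z : ℝ × ℝ, f z.1 * f z.2 *
        (fourierKernel M z.1 z.2 * fourierKernel M z.2 z.1) ∂(volume.prod volume) := by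
    rw [← integral_complex_ofReal]
    simp only [hreal]
    rw [integral_add hdiff (integrable_const _), integral_sub hSSi hlin, integral_const_mul, s2, ha]
    simp only [hSS]
    rw [integral_add q1 j1, q2, two]
    simp
    ring
  refine ⟨?_, ?_⟩
  · have := hall.re
    refine this.congr (Filter.Eventually.of_forall fun X => ?_)
    simp only [← hreal]
    exact Complex.ofReal_re _
  have hW : Integrable fun u => ‖𝓕 (f : ℝ → ℂ) u‖ ^ 2 := by
    rw [← SchwartzMap.fourier_coe]
    exact (memLp_two_iff_integrable_sq_norm
      (𝓕 f).continuous.aestronglyMeasurable).1 ((𝓕 f).memLp 2)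
  have hplan : ∫ x, f x ^ 2 = ((∫ u, ‖𝓕 (f : ℝ → ℂ) u‖ ^ 2 : ℝ) : ℂ) := by
    rw [← SchwartzMap.fourier_coe, SchwartzMap.integral_norm_sq_fourier, ← integral_complex_ofReal]
    refine integral_congr_ae (Filter.Eventually.of_forall fun x => ?_)
    simp [hfg']
  have hfreq : ∫ w : ℝ × ℝ, (M.indicator (fun _ => (1 : ℂ)) w.1 *
        M.indicator (fun _ => (1 : ℂ)) w.2) *
        (𝓕 (f : ℝ → ℂ) (w.1 - w.2) * 𝓕 (f : ℝ → ℂ) (w.2 - w.1)) ∂(volume.prod volume) =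
      ((∫ w : ℝ × ℝ, (M.indicator (fun _ => (1 : ℝ)) w.1 * M.indicator (fun _ => (1 : ℝ)) w.2) *
        ‖𝓕 (f : ℝ → ℂ) (w.1 - w.2)‖ ^ 2 ∂(volume.prod volume) : ℝ) : ℂ) := by
    rw [← integral_complex_ofReal]
    refine integral_congr_ae (Filter.Eventually.of_forall fun w => ?_)
    have h1 : 𝓕 (f : ℝ → ℂ) (w.2 - w.1) = (starRingEnd ℂ) (𝓕 (f : ℝ → ℂ) (w.1 - w.2)) := by
      rw [hfg, ← fourier_neg_of_real, neg_sub]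
    have h2 : ∀ s, M.indicator (fun _ => (1 : ℂ)) s = ((M.indicator (fun _ => (1 : ℝ)) s : ℝ) : ℂ) :=
      fun s => by by_cases hs : s ∈ M <;> simp [hs]
    simp only [h1, h2, Complex.mul_conj, Complex.normSq_eq_norm_sq]
    simp
  rw [hkk.2, hplan, hfreq] at hvar
  norm_cast at hvar
  rw [hvar, measureReal_mul_integral_sub hM hfin hW, ← integral_const_mul]
  have hFi : Integrable fun u => ‖𝓕 (f : ℝ → ℂ) u‖ := by
    rw [← SchwartzMap.fourier_coe]
    exact (𝓕 f).integrable.norm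
  -- One factor |f̂| is absorbed with the weight into b; the other stays under the integral.
  refine integral_mono_of_nonneg (Filter.Eventually.of_forall fun u => by positivity)
    (hFi.const_mul b) (Filter.Eventually.of_forall fun u => ?_)
  have := mul_le_mul_of_nonneg_right (hb u) (norm_nonneg (𝓕 (f : ℝ → ℂ) u))
  simp only [sq, ← mul_assoc]
  exact this

end Variance

/-! ### Test functions -/

/-- The right side is an increment of t / (1 + t) from u to 2u, so sums over dyadic scales
telescope. -/
lemma div_one_add_sq_le_sub {u : ℝ} (hu : 0 ≤ u) :
    u / (1 + u ^ 2) ≤ 4 * (2 * u / (1 + 2 * u) - u / (1 + u)) := by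
  have h : 2 * u / (1 + 2 * u) - u / (1 + u) = u / ((1 + 2 * u) * (1 + u)) := by
    field_simp
    ring
  rw [h, ← mul_div_assoc, div_le_div_iff₀ (by positivity) (by positivity)]
  nlinarith [mul_nonneg hu (sq_nonneg (u - 1)), mul_nonneg hu (sq_nonneg u)]

/-- Each frequency is felt by boundedly many dyadic scales. Independence of m is what yields the
gain 1/m after averaging. -/
lemma sum_dyadic_le {u : ℝ} (hu : 0 ≤ u) (m : ℕ) :
    ∑ k ∈ Finset.range m, 2 ^ k * u / (1 + (2 ^ k * u) ^ 2) ≤ 4 := by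
  let F : ℕ → ℝ := fun k => 2 ^ k * u / (1 + 2 ^ k * u)
  calc ∑ k ∈ Finset.range m, 2 ^ k * u / (1 + (2 ^ k * u) ^ 2)
      ≤ ∑ k ∈ Finset.range m, 4 * (F (k + 1) - F k) := by
        refine Finset.sum_le_sum fun k _ => ?_
        have := div_one_add_sq_le_sub (u := 2 ^ k * u) (by positivity)
        simpa only [F, pow_succ', mul_assoc] using this
    _ = 4 * (F m - F 0) := by rw [← Finset.mul_sum, Finset.sum_range_sub]
    _ ≤ 4 := by
        have h1 : F m ≤ 1 := div_le_one_of_le₀ (by linarith [show 0 ≤ 2 ^ m * u by positivity])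
          (by positivity)
        have h0 : 0 ≤ F 0 := by positivity
        linarith

lemma fourier_comp_inv_mul (f : ℝ → ℂ) {r : ℝ} (hr : 0 < r) (u : ℝ) :
    𝓕 (fun x => f (r⁻¹ * x)) u = r * 𝓕 f (r * u) := by
  rw [fourier_eq_integral_expChar, fourier_eq_integral_expChar]
  have := Measure.integral_comp_mul_left (fun x => f x * expChar (x * (r * u))) r⁻¹
  rw [inv_inv, abs_of_pos hr, Complex.real_smul] at this
  rw [← this]
  refine integral_congr_ae (Filter.Eventually.of_forall fun v => ?_)
  have : r⁻¹ * v * (r * u) = v * u := by field_simp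
  simp only [this]

/-- Averages of dyadic dilates of a bump function: smooth compactly supported functions that equal
`1` on a given interval and whose norm in `H^{1/2}` is as small as desired. -/
theorem exists_bump_fourier_bounds : ∃ D D₁ : ℝ, 0 ≤ D ∧ 0 ≤ D₁ ∧ ∀ R : ℝ, 0 < R → ∀ m : ℕ, 0 < m →
    ∃ (g : ℝ → ℝ) (f : SchwartzMap ℝ ℂ), (⇑f = fun x => (g x : ℂ)) ∧ HasCompactSupport f ∧
      HasCompactSupport g ∧ 0 ≤ g ∧ Continuous g ∧ (∀ x, |x| ≤ R → g x = 1) ∧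
      (∀ u, ‖𝓕 (f : ℝ → ℂ) u‖ ≤ D * R * 2 ^ m) ∧ (∀ u, |u| * ‖𝓕 (f : ℝ → ℂ) u‖ ≤ D / m) ∧
      ∫ u, ‖𝓕 (f : ℝ → ℂ) u‖ ≤ D₁ := by
  let ψ : ContDiffBump (0 : ℝ) := ⟨1, 2, one_pos, one_lt_two⟩
  have hψc : HasCompactSupport fun x => ((ψ x : ℝ) : ℂ) :=
    ψ.hasCompactSupport.comp_left (g := fun t : ℝ => (t : ℂ)) Complex.ofReal_zero
  have hψs : ContDiff ℝ (⊤ : ℕ∞) fun x => ((ψ x : ℝ) : ℂ) :=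
    Complex.ofRealCLM.contDiff.comp ψ.contDiff
  let p : SchwartzMap ℝ ℂ := hψc.toSchwartzMap hψs
  have hp : ∀ x, p x = ((ψ x : ℝ) : ℂ) := fun x => rfl
  let Ψ : SchwartzMap ℝ ℂ := 𝓕 p
  obtain ⟨D0, hD0, h0⟩ := Ψ.decay 0 0
  obtain ⟨D2, hD2, h2⟩ := Ψ.decay 2 0
  -- Quadratic decay is all that `sum_dyadic_le` requires.
  have hΨ : ∀ x, ‖Ψ x‖ ≤ (D0 + D2) / (1 + x ^ 2) := fun x => by
    have e0 := h0 x
    have e2 := h2 x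
    simp only [pow_zero, one_mul, norm_iteratedFDeriv_zero, Real.norm_eq_abs, sq_abs] at e0 e2
    rw [le_div_iff₀ (by positivity)]
    linarith
  set D := D0 + D2
  have hD : 0 ≤ D := by positivity
  refine ⟨4 * D, ∫ u, ‖Ψ u‖, by positivity, integral_nonneg fun _ => norm_nonneg _,
    fun R hR m hm => ?_⟩
  have hm' : (0 : ℝ) < m := Nat.cast_pos.2 hm
  let r : ℕ → ℝ := fun k => R * 2 ^ k
  have hr : ∀ k, 0 < r k := fun k => by positivity
  let g : ℝ → ℝ := fun x => (m : ℝ)⁻¹ * ∑ k ∈ Finset.range m, ψ ((r k)⁻¹ * x)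
  have hgc : HasCompactSupport g := by
    refine HasCompactSupport.intro (isCompact_closedBall (0 : ℝ) (2 * r m)) fun x hx => ?_
    rw [Metric.mem_closedBall, not_le] at hx
    simp only [g]
    rw [Finset.sum_eq_zero fun k hk => ?_, mul_zero]
    refine ψ.zero_of_le_dist ?_
    rw [Real.dist_0_eq_abs] at hx ⊢
    rw [abs_mul, abs_of_pos (inv_pos.2 (hr k)), inv_mul_eq_div, le_div_iff₀ (hr k)]
    have : r k ≤ r m := mul_le_mul_of_nonneg_left
      (pow_le_pow_right₀ one_le_two (Finset.mem_range.1 hk).le) hR.le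
    change 2 * r k ≤ |x|
    linarith
  have hgs : ContDiff ℝ (⊤ : ℕ∞) g :=
    contDiff_const.mul (ContDiff.sum fun k _ => ψ.contDiff.comp (contDiff_const.mul contDiff_id))
  have hfc : HasCompactSupport fun x => (g x : ℂ) :=
    hgc.comp_left (g := fun t : ℝ => (t : ℂ)) Complex.ofReal_zero
  have hfs : ContDiff ℝ (⊤ : ℕ∞) fun x => (g x : ℂ) := Complex.ofRealCLM.contDiff.comp hgs
  let f : SchwartzMap ℝ ℂ := hfc.toSchwartzMap hfs
  have hF : ∀ u, 𝓕 (f : ℝ → ℂ) u =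
      (m : ℂ)⁻¹ * ∑ k ∈ Finset.range m, (r k : ℂ) * Ψ (r k * u) := fun u => by
    have hΨ' : ∀ k, (r k : ℂ) * Ψ (r k * u) = 𝓕 (fun x => p ((r k)⁻¹ * x)) u := fun k =>
      (fourier_comp_inv_mul p (hr k) u).symm
    simp only [hΨ', fourier_eq_integral_expChar]
    rw [← integral_finsetSum, ← integral_const_mul]
    · refine integral_congr_ae (Filter.Eventually.of_forall fun v => ?_)
      have : f v = (m : ℂ)⁻¹ * ∑ k ∈ Finset.range m, p ((r k)⁻¹ * v) := by
        change ((g v : ℝ) : ℂ) = _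
        simp only [g, hp]
        push_cast
        rfl
      simp only [this, mul_assoc, Finset.sum_mul]
    · intro k _
      refine (p.integrable.comp_mul_left' (inv_ne_zero (hr k).ne')).mul_bdd (c := 1)
        (Continuous.aestronglyMeasurable (by fun_prop))
        (Filter.Eventually.of_forall fun v => (norm_expChar _).le)
  have hFn : ∀ u, ‖𝓕 (f : ℝ → ℂ) u‖ ≤
      (m : ℝ)⁻¹ * ∑ k ∈ Finset.range m, r k * ‖Ψ (r k * u)‖ := fun u => by
    rw [hF, norm_mul, norm_inv, Complex.norm_natCast]
    refine mul_le_mul_of_nonneg_left ((norm_sum_le _ _).trans_eq ?_) (by positivity)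
    refine Finset.sum_congr rfl fun k _ => ?_
    rw [norm_mul, Complex.norm_real, Real.norm_of_nonneg (hr k).le]
  refine ⟨g, f, rfl, hfc, hgc, ?_, hgs.continuous, ?_, ?_, ?_, ?_⟩
  · intro x
    exact mul_nonneg (by positivity) (Finset.sum_nonneg fun k _ => ψ.nonneg)
  · intro x hx
    have : ∀ k ∈ Finset.range m, ψ ((r k)⁻¹ * x) = 1 := fun k _ => by
      refine ψ.one_of_mem_closedBall ?_
      rw [Metric.mem_closedBall, Real.dist_0_eq_abs, abs_mul, abs_of_pos (inv_pos.2 (hr k)),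
        inv_mul_eq_div]
      refine div_le_one_of_le₀ (hx.trans ?_) (hr k).le
      exact le_mul_of_one_le_right hR.le (one_le_pow₀ one_le_two)
    simp only [g]
    rw [Finset.sum_congr rfl this]
    simp [hm'.ne']
  · intro u
    refine (hFn u).trans ?_
    calc (m : ℝ)⁻¹ * ∑ k ∈ Finset.range m, r k * ‖Ψ (r k * u)‖
        ≤ (m : ℝ)⁻¹ * ∑ k ∈ Finset.range m, (R * 2 ^ m) * D := by
          refine mul_le_mul_of_nonneg_left (Finset.sum_le_sum fun k hk => ?_) (by positivity)
          refine mul_le_mul ?_ ?_ (norm_nonneg _) (by positivity)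
          · exact mul_le_mul_of_nonneg_left
              (pow_le_pow_right₀ one_le_two (Finset.mem_range.1 hk).le) hR.le
          · refine (hΨ _).trans (div_le_self hD ?_)
            linarith [sq_nonneg (r k * u)]
      _ = D * R * 2 ^ m := by
          simp only [Finset.sum_const, Finset.card_range, nsmul_eq_mul]
          field_simp
      _ ≤ 4 * D * R * 2 ^ m := by
          have : 0 ≤ D * R * 2 ^ m := by positivity
          linarith
  · intro u
    calc |u| * ‖𝓕 (f : ℝ → ℂ) u‖
        ≤ |u| * ((m : ℝ)⁻¹ * ∑ k ∈ Finset.range m, r k * ‖Ψ (r k * u)‖) :=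
          mul_le_mul_of_nonneg_left (hFn u) (abs_nonneg u)
      _ = (m : ℝ)⁻¹ * ∑ k ∈ Finset.range m, (r k * |u|) * ‖Ψ (r k * u)‖ := by
          rw [mul_left_comm, Finset.mul_sum]
          refine congrArg _ (Finset.sum_congr rfl fun k _ => by ring)
      _ ≤ (m : ℝ)⁻¹ * ∑ k ∈ Finset.range m,
            D * (2 ^ k * (R * |u|) / (1 + (2 ^ k * (R * |u|)) ^ 2)) := by
          refine mul_le_mul_of_nonneg_left (Finset.sum_le_sum fun k hk => ?_) (by positivity)
          have e : 2 ^ k * (R * |u|) = r k * |u| := by simp only [r]; ring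
          rw [e, mul_pow, sq_abs, ← mul_pow, mul_div_left_comm]
          exact mul_le_mul_of_nonneg_left (hΨ _) (mul_nonneg (hr k).le (abs_nonneg u))
      _ ≤ (m : ℝ)⁻¹ * (D * 4) := by
          rw [← Finset.mul_sum]
          refine mul_le_mul_of_nonneg_left (mul_le_mul_of_nonneg_left ?_ hD) (by positivity)
          exact sum_dyadic_le (mul_nonneg hR.le (abs_nonneg u)) m
      _ = 4 * D / m := by ring
  · have hi : ∀ k ∈ Finset.range m, Integrable fun u => r k * ‖Ψ (r k * u)‖ := fun k _ =>
      ((Ψ.integrable.comp_mul_left' (hr k).ne').norm).const_mul _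
    calc ∫ u, ‖𝓕 (f : ℝ → ℂ) u‖
        ≤ ∫ u, (m : ℝ)⁻¹ * ∑ k ∈ Finset.range m, r k * ‖Ψ (r k * u)‖ :=
          integral_mono_of_nonneg (Filter.Eventually.of_forall fun u => norm_nonneg _)
            ((integrable_finsetSum _ hi).const_mul _) (Filter.Eventually.of_forall hFn)
      _ = (m : ℝ)⁻¹ * ∑ k ∈ Finset.range m, ∫ u, ‖Ψ u‖ := by
          rw [integral_const_mul, integral_finsetSum _ hi]
          refine congrArg _ (Finset.sum_congr rfl fun k _ => ?_)
          -- Dilation preserves the L¹ norm of the Fourier transform, so the average has a bound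
          -- free of R and m.
          rw [integral_const_mul, Measure.integral_comp_mul_left (fun u => ‖Ψ u‖), smul_eq_mul,
            abs_of_pos (inv_pos.2 (hr k)), mul_inv_cancel_left₀ (hr k).ne']
      _ = ∫ u, ‖Ψ u‖ := by
          simp only [Finset.sum_const, Finset.card_range, nsmul_eq_mul]
          field_simp
      _ ≤ ∫ u, ‖Ψ u‖ := le_rfl

/-! ### Translates of generalized Cantor sets -/

/-- The size of the part of `M` that is not covered by the translate `M + u`. -/
noncomputable def translateDefect (M : Set ℝ) (u : ℝ) : ℝ≥0∞ := volume (M ∩ (fun s => s - u) ⁻¹' Mᶜ)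

lemma volume_preimage_sub_right (A : Set ℝ) (u : ℝ) :
    volume ((fun s => s - u) ⁻¹' A) = volume A := by
  simp only [sub_eq_add_neg]
  exact measure_preimage_add_right volume (-u) A

/-- Only a sliver of length at most |u| at one end can be lost, whatever the length of the interval.
-/
lemma translateDefect_Icc_le (a b u : ℝ) :
    translateDefect (Icc a b) u ≤ ENNReal.ofReal |u| := by
  rcases le_total 0 u with hu | hu
  · have hsub : Icc a b ∩ (fun s => s - u) ⁻¹' (Icc a b)ᶜ ⊆ Icc a (a + u) := by
      rintro s ⟨⟨h1, h2⟩, h3⟩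
      refine ⟨h1, ?_⟩
      by_contra! h
      exact h3 ⟨by linarith, by linarith⟩
    refine (measure_mono hsub).trans_eq ?_
    rw [Real.volume_Icc, abs_of_nonneg hu, add_sub_cancel_left]
  · have hsub : Icc a b ∩ (fun s => s - u) ⁻¹' (Icc a b)ᶜ ⊆ Icc (b + u) b := by
      rintro s ⟨⟨h1, h2⟩, h3⟩
      refine ⟨?_, h2⟩
      by_contra! h
      exact h3 ⟨by linarith, by linarith⟩
    refine (measure_mono hsub).trans_eq ?_
    rw [Real.volume_Icc, abs_of_nonpos hu, sub_add_cancel_left]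

lemma measure_biUnion_list_le {ι : Type*} (l : List ι) (s : ι → Set ℝ) {c : ℝ≥0∞}
    (h : ∀ p ∈ l, volume (s p) ≤ c) : volume (⋃ p ∈ l, s p) ≤ l.length * c := by
  induction l with
  | nil => simp
  | cons a l ih =>
    have hU : (⋃ p ∈ a :: l, s p) = s a ∪ ⋃ p ∈ l, s p := by
      ext x
      simp
    rw [hU, List.length_cons, Nat.cast_add, Nat.cast_one, add_mul, one_mul, add_comm]
    exact (measure_union_le _ _).trans
      (add_le_add (h a (by simp)) (ih fun p hp => h p (by simp [hp])))

/-- A point lost by the union is lost by the interval that contains it. -/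
lemma translateDefect_biUnion_le (l : List (ℝ × ℝ)) (u : ℝ) :
    translateDefect (⋃ p ∈ l, Icc p.1 p.2) u ≤ l.length * ENNReal.ofReal |u| := by
  refine le_trans (measure_mono ?_) (measure_biUnion_list_le l
    (fun p => Icc p.1 p.2 ∩ (fun s => s - u) ⁻¹' (Icc p.1 p.2)ᶜ)
    fun p _ => translateDefect_Icc_le p.1 p.2 u)
  rintro s ⟨h1, h2⟩
  simp only [mem_iUnion, mem_preimage, mem_compl_iff, not_exists] at h1 h2 ⊢
  obtain ⟨p, hp, hs⟩ := h1
  exact ⟨p, hp, hs, h2 p hp⟩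

section Cantor

variable {α : ℕ → ℝ}

lemma length_cantorIntervals (n : ℕ) : (cantorIntervals α n).length = 2 ^ n := by
  induction n with
  | zero => rfl
  | succ n ih =>
    rw [cantorIntervals, List.length_flatMap]
    simp [removeMiddle, ih, pow_succ]

lemma sub_of_mem_cantorIntervals (n : ℕ) {p : ℝ × ℝ} (hp : p ∈ cantorIntervals α n) :
    p.2 - p.1 = (∏ k ∈ Finset.Ico 1 (n + 1), (1 - α k)) / 2 ^ n := by
  induction n generalizing p with
  | zero =>
    obtain rfl : p = (0, 1) := by simpa [cantorIntervals] using hp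
    simp
  | succ n ih =>
    rw [cantorIntervals, List.mem_flatMap] at hp
    obtain ⟨q, hq, hp⟩ := hp
    have hlen : p.2 - p.1 = (q.2 - q.1) * (1 - α (n + 1)) / 2 := by
      simp only [removeMiddle, List.mem_cons, List.not_mem_nil, or_false] at hp
      rcases hp with rfl | rfl <;> ring
    rw [hlen, ih hq, Finset.prod_Ico_succ_top (Nat.le_add_left 1 n), pow_succ]
    ring

lemma le_of_mem_cantorIntervals (hα : ∀ n, 1 ≤ n → 0 < α n ∧ α n < 1)
    (n : ℕ) {p : ℝ × ℝ} (hp : p ∈ cantorIntervals α n) :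
    p.1 ≤ p.2 := by
  have h : 0 ≤ p.2 - p.1 := by
    rw [sub_of_mem_cantorIntervals n hp]
    refine div_nonneg (Finset.prod_nonneg fun k hk => ?_) (by positivity)
    linarith [(hα k (Finset.mem_Ico.1 hk).1).2]
  linarith

lemma antitone_cantorStage (hα : ∀ n, 1 ≤ n → 0 < α n ∧ α n < 1)
    : Antitone (cantorStage α) := by
  refine antitone_nat_of_succ_le fun n x hx => ?_
  simp only [cantorStage, mem_iUnion, cantorIntervals, List.mem_flatMap] at hx ⊢
  obtain ⟨p, ⟨q, hq, hp⟩, hx⟩ := hx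
  refine ⟨q, hq, ?_⟩
  have hle := le_of_mem_cantorIntervals hα n hq
  obtain ⟨h0, h1⟩ := hα (n + 1) (by omega)
  have e1 : 0 ≤ α (n + 1) * (q.2 - q.1) := mul_nonneg h0.le (by linarith)
  have e2 : 0 ≤ (1 - α (n + 1)) * (q.2 - q.1) := mul_nonneg (by linarith) (by linarith)
  simp only [removeMiddle, List.mem_cons, List.not_mem_nil, or_false] at hp
  rcases hp with rfl | rfl
  · exact ⟨hx.1, by have := hx.2; dsimp only at this; linarith⟩
  · exact ⟨by have := hx.1; dsimp only at this; linarith, hx.2⟩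

lemma volume_cantorStage_diff_le (n : ℕ) :
    volume (cantorStage α n \ cantorStage α (n + 1)) ≤
      ENNReal.ofReal (2 ^ n * gapLength α (n + 1)) := by
  let s : ℝ × ℝ → Set ℝ := fun p => Ioo ((p.1 + p.2) / 2 - α (n + 1) * (p.2 - p.1) / 2)
    ((p.1 + p.2) / 2 + α (n + 1) * (p.2 - p.1) / 2)
  have hsub : cantorStage α n \ cantorStage α (n + 1) ⊆ ⋃ p ∈ cantorIntervals α n, s p := by
    rintro x ⟨h1, h2⟩
    simp only [cantorStage, mem_iUnion, cantorIntervals, List.mem_flatMap, not_exists] at h1 h2 ⊢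
    obtain ⟨q, hq, hx⟩ := h1
    refine ⟨q, hq, ?_, ?_⟩
    · by_contra! h
      exact h2 (q.1, (q.1 + q.2) / 2 - α (n + 1) * (q.2 - q.1) / 2)
        ⟨q, hq, by simp [removeMiddle]⟩ ⟨hx.1, h⟩
    · by_contra! h
      exact h2 ((q.1 + q.2) / 2 + α (n + 1) * (q.2 - q.1) / 2, q.2)
        ⟨q, hq, by simp [removeMiddle]⟩ ⟨h, hx.2⟩
  refine (measure_mono hsub).trans ((measure_biUnion_list_le _ s
    (c := ENNReal.ofReal (gapLength α (n + 1))) fun p hp => ?_).trans_eq ?_)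
  · rw [Real.volume_Ioo]
    refine le_of_eq (congrArg _ ?_)
    have := sub_of_mem_cantorIntervals n hp
    rw [gapLength, Nat.add_sub_cancel]
    linear_combination α (n + 1) * this
  · rw [length_cantorIntervals, ENNReal.ofReal_mul (by positivity)]
    norm_num [ENNReal.ofReal_pow]

lemma volume_cantorStage_diff_genCantorSet_le (hα : ∀ n, 1 ≤ n → 0 < α n ∧ α n < 1)
    (n : ℕ) :
    volume (cantorStage α n \ genCantorSet α) ≤
      ∑' k, ENNReal.ofReal (2 ^ (n + k) * gapLength α (n + k + 1)) := by
  have hsub : cantorStage α n \ genCantorSet α ⊆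
      ⋃ k, cantorStage α (n + k) \ cantorStage α (n + k + 1) := by
    rintro x ⟨h1, h2⟩
    by_contra h
    simp only [mem_iUnion, mem_sdiff, not_exists, not_and, not_not] at h
    have hall : ∀ k, x ∈ cantorStage α (n + k) := fun k => by
      induction k with
      | zero => exact h1
      | succ k ih => exact h k ih
    refine h2 (mem_iInter.2 fun j => antitone_cantorStage hα (Nat.le_add_left j n) (hall j))
  exact (measure_mono hsub).trans ((measure_iUnion_le _).trans
    (ENNReal.tsum_le_tsum fun k => volume_cantorStage_diff_le (n + k)))

lemma measurableSet_genCantorSet : MeasurableSet (genCantorSet α) := by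
  refine MeasurableSet.iInter fun n => ?_
  exact (Set.Finite.isClosed_biUnion (List.finite_toSet _) fun _ _ => isClosed_Icc).measurableSet

lemma genCantorSet_subset_Icc : genCantorSet α ⊆ Icc 0 1 := by
  refine (iInter_subset _ 0).trans_eq ?_
  simp [cantorStage, cantorIntervals]

/-- If s is in C and s - u is not, then either s - u leaves C_n, which 2^n intervals control, or s -
u lies in C_n \ C. The level n is free and is later matched to the test function. -/
lemma translateDefect_genCantorSet_le (hα : ∀ n, 1 ≤ n → 0 < α n ∧ α n < 1)
    (n : ℕ) (u : ℝ) :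
    translateDefect (genCantorSet α) u ≤ 2 ^ n * ENNReal.ofReal |u| +
      ∑' k, ENNReal.ofReal (2 ^ (n + k) * gapLength α (n + k + 1)) := by
  have hsub : genCantorSet α ∩ (fun s => s - u) ⁻¹' (genCantorSet α)ᶜ ⊆
      (cantorStage α n ∩ (fun s => s - u) ⁻¹' (cantorStage α n)ᶜ) ∪
        (fun s => s - u) ⁻¹' (cantorStage α n \ genCantorSet α) := by
    rintro s ⟨h1, h2⟩
    by_cases h : s - u ∈ cantorStage α n
    · exact Or.inr ⟨h, h2⟩
    · exact Or.inl ⟨mem_iInter.1 h1 n, h⟩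
  refine (measure_mono hsub).trans ((measure_union_le _ _).trans (add_le_add ?_ ?_))
  · refine (translateDefect_biUnion_le (cantorIntervals α n) u).trans_eq ?_
    rw [length_cantorIntervals]
    norm_num
  · rw [volume_preimage_sub_right]
    exact volume_cantorStage_diff_genCantorSet_le hα n

/-- If s - u stays in [0, 1] but not in the complement of C, then s - u is a point of C whose shift
by u leaves C. -/
lemma translateDefect_Icc_diff_le (C : Set ℝ) (u : ℝ) :
    translateDefect (Icc 0 1 \ C) u ≤ ENNReal.ofReal |u| + translateDefect C (-u) := by
  have hsub : (Icc 0 1 \ C) ∩ (fun s => s - u) ⁻¹' (Icc 0 1 \ C)ᶜ ⊆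
      (Icc 0 1 ∩ (fun s => s - u) ⁻¹' (Icc 0 1)ᶜ) ∪
        (fun s => s - u) ⁻¹' (C ∩ (fun s => s - -u) ⁻¹' Cᶜ) := by
    rintro s ⟨⟨h1, h2⟩, h3⟩
    by_cases h : s - u ∈ Icc (0 : ℝ) 1
    · refine Or.inr ⟨?_, by simpa using h2⟩
      by_contra h4
      exact h3 ⟨h, h4⟩
    · exact Or.inl ⟨h1, h⟩
  refine (measure_mono hsub).trans ((measure_union_le _ _).trans
    (add_le_add (translateDefect_Icc_le 0 1 u) ?_))
  rw [volume_preimage_sub_right]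
  rfl

lemma gapLength_nonneg (hα : ∀ n, 1 ≤ n → 0 < α n ∧ α n < 1)
    (n : ℕ) : 0 ≤ gapLength α (n + 1) := by
  refine div_nonneg (mul_nonneg (Finset.prod_nonneg fun k hk => ?_) (hα _ (by omega)).1.le)
    (by positivity)
  linarith [(hα k (Finset.mem_Ico.1 hk).1).2]

/-- Summands tend to 0, hence are eventually at most 1/2; raising to the power 4^(n/δ) ≥ 4^n gives
the bound. -/
lemma eventually_gapLength_le (hα : ∀ n, 1 ≤ n → 0 < α n ∧ α n < 1)
    {δ : ℝ} (h0 : 0 < δ) (h1 : δ < 1)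
    (hs : Summable fun n : ℕ =>
      gapLength α (n + 1) ^ ((1 : ℝ) / (4 : ℝ) ^ (((n + 1 : ℕ) : ℝ) / δ))) :
    ∀ᶠ n : ℕ in Filter.atTop, gapLength α (n + 1) ≤ (1 / 2) ^ (4 ^ (n + 1)) := by
  filter_upwards [hs.tendsto_atTop_zero.eventually_le_const (show (0 : ℝ) < 1 / 2 by norm_num)]
    with n hn
  set Q : ℝ := (4 : ℝ) ^ (((n + 1 : ℕ) : ℝ) / δ)
  have hQ : 0 < Q := by positivity
  have hQ4 : ((4 ^ (n + 1) : ℕ) : ℝ) ≤ Q := by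
    rw [Nat.cast_pow, ← Real.rpow_natCast]
    refine Real.rpow_le_rpow_of_exponent_le (by norm_num) ?_
    exact le_div_self (by positivity) h0 h1.le
  have hx := gapLength_nonneg hα n
  calc gapLength α (n + 1) = (gapLength α (n + 1) ^ (1 / Q)) ^ Q := by
        rw [← Real.rpow_mul hx, one_div_mul_cancel hQ.ne', Real.rpow_one]
    _ ≤ (1 / 2 : ℝ) ^ Q := Real.rpow_le_rpow (by positivity) hn hQ.le
    _ ≤ (1 / 2 : ℝ) ^ ((4 ^ (n + 1) : ℕ) : ℝ) :=
        Real.rpow_le_rpow_of_exponent_ge (by norm_num) (by norm_num) hQ4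
    _ = (1 / 2) ^ (4 ^ (n + 1)) := Real.rpow_natCast _ _

lemma eventually_tsum_gapLength_le
    (h : ∀ᶠ n : ℕ in Filter.atTop, gapLength α (n + 1) ≤ (1 / 2) ^ (4 ^ (n + 1))) :
    ∀ᶠ n : ℕ in Filter.atTop, ∑' k, ENNReal.ofReal (2 ^ (n + k) * gapLength α (n + k + 1)) ≤
      ENNReal.ofReal (2 * (1 / 2) ^ 3 ^ n * (1 / 2) ^ n) := by
  filter_upwards [Filter.eventually_forall_ge_atTop.2 h] with n hn
  have hterm : ∀ k, 2 ^ (n + k) * gapLength α (n + k + 1) ≤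
      ((1 / 2) ^ 3 ^ n * (1 / 2) ^ n) * (1 / 2 : ℝ) ^ k := fun k => by
    -- One n + k cancels the number 2^(n+k) of gaps, the other supplies the decay in n and k.
    have h3 : 3 ^ n + 2 * (n + k) ≤ 4 ^ (n + k + 1) := by
      have e1 : 3 ^ n ≤ 4 ^ (n + k) := (Nat.pow_le_pow_left (by norm_num) n).trans
        (Nat.pow_le_pow_right (by norm_num) (Nat.le_add_right n k))
      have e2 : n + k < 4 ^ (n + k) := Nat.lt_pow_self (by norm_num)
      rw [pow_succ]
      omega
    calc 2 ^ (n + k) * gapLength α (n + k + 1)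
        ≤ 2 ^ (n + k) * (1 / 2 : ℝ) ^ (4 ^ (n + k + 1)) :=
          mul_le_mul_of_nonneg_left (hn (n + k) (Nat.le_add_right n k)) (by positivity)
      _ ≤ 2 ^ (n + k) * (1 / 2 : ℝ) ^ (3 ^ n + 2 * (n + k)) :=
          mul_le_mul_of_nonneg_left (pow_le_pow_of_le_one (by norm_num) (by norm_num) h3)
            (by positivity)
      _ = ((2 : ℝ) * (1 / 2)) ^ (n + k) * (((1 / 2) ^ 3 ^ n * (1 / 2) ^ n) * (1 / 2 : ℝ) ^ k) := by
          rw [mul_pow, pow_add _ (3 ^ n), two_mul, pow_add _ (n + k), pow_add (1 / 2 : ℝ) n k]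
          ring
      _ = _ := by norm_num
  have hgeo : HasSum (fun k : ℕ => ((1 / 2) ^ 3 ^ n * (1 / 2) ^ n) * (1 / 2 : ℝ) ^ k)
      (((1 / 2) ^ 3 ^ n * (1 / 2) ^ n) * 2) := hasSum_geometric_two.mul_left _
  calc ∑' k, ENNReal.ofReal (2 ^ (n + k) * gapLength α (n + k + 1))
      ≤ ∑' k, ENNReal.ofReal (((1 / 2) ^ 3 ^ n * (1 / 2) ^ n) * (1 / 2 : ℝ) ^ k) :=
        ENNReal.tsum_le_tsum fun k => ENNReal.ofReal_le_ofReal (hterm k)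
    _ = ENNReal.ofReal (((1 / 2) ^ 3 ^ n * (1 / 2) ^ n) * 2) := by
        rw [← hgeo.tsum_eq, ENNReal.ofReal_tsum_of_nonneg (fun k => by positivity) hgeo.summable]
    _ = _ := congrArg _ (by ring)

end Cantor

/-! ### Rigidity -/

/-- A determinantal process with kernel `K_M` is number rigid as soon as the translates of `M`
differ little from `M`, in a multi-scale sense. -/
theorem isNumberRigid_of_translateDefect_le {M : Set ℝ} (hM : MeasurableSet M)
    (hfin : volume M ≠ ∞)
    (h : ∀ᶠ n : ℕ in Filter.atTop, ∀ u, translateDefect M u ≤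
      (2 ^ n + 1) * ENNReal.ofReal |u| + ENNReal.ofReal (2 * (1 / 2) ^ 3 ^ n * (1 / 2) ^ n))
    {P : Measure (Conf ℝ)} [IsProbabilityMeasure P]
    (hP : IsDeterminantal (fourierKernel M) volume P) : IsNumberRigid P := by
  refine isNumberRigid_of_tendsto hP.simple fun B hB => ?_
  obtain ⟨R, hR, hBR⟩ := hB.isBounded.subset_closedBall_lt 0 0
  obtain ⟨D, D₁, hD, hD₁, hex⟩ := exists_bump_fourier_bounds
  -- With m = 3^n scales, 1/m beats the 2^n intervals, while 2^m is cancelled exactly by the factor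
  -- (1/2)^(3^n) of the tail.
  choose g f hfg hf hg hg0 hgc hg1 hF1 hF2 hF3 using
    fun n : ℕ => hex R hR (3 ^ n) (by positivity)
  let b : ℕ → ℝ := fun n => (2 ^ n + 1) * (D / 3 ^ n) + 2 * (1 / 2) ^ n * (D * R)
  have hb : Filter.Tendsto (fun n => b n * D₁) Filter.atTop (nhds 0) := by
    have t1 := tendsto_pow_atTop_nhds_zero_of_lt_one (show (0 : ℝ) ≤ 2 / 3 by norm_num)
      (by norm_num)
    have t2 := tendsto_pow_atTop_nhds_zero_of_lt_one (show (0 : ℝ) ≤ 1 / 3 by norm_num)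
      (by norm_num)
    have t3 := tendsto_pow_atTop_nhds_zero_of_lt_one (show (0 : ℝ) ≤ 1 / 2 by norm_num)
      (by norm_num)
    have := ((((t1.add t2).mul_const D).add ((t3.const_mul 2).mul_const (D * R)))).mul_const D₁
    simp only [add_zero, zero_mul, mul_zero] at this
    refine this.congr fun n => ?_
    simp only [b, div_pow, one_pow]
    ring
  let S : ℕ → Conf ℝ → ℂ := fun n X =>
    Conf.tupleSum (fun x : Fin 1 → ℝ => (g n (x 0) : ℂ)) X - (volume.real M * ∫ x, g n x : ℝ)
  have hvar : ∀ᶠ n in Filter.atTop, Integrable (fun X => ‖S n X‖ ^ 2) P ∧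
      ∫ X, ‖S n X‖ ^ 2 ∂P ≤ b n * D₁ := by
    filter_upwards [h] with n hn
    have hbn : 0 ≤ b n := by positivity
    obtain ⟨h1, h2⟩ := integral_norm_sq_tupleSum_sub_le hM hfin hP (g n) (f n) (hfg n) (hf n)
      (b := b n) fun u => by
        have hle : volume.real (M ∩ (fun s => s - u) ⁻¹' Mᶜ) ≤
            (2 ^ n + 1) * |u| + 2 * (1 / 2) ^ 3 ^ n * (1 / 2) ^ n := by
          refine ENNReal.toReal_le_of_le_ofReal (by positivity) ((hn u).trans_eq ?_)
          rw [ENNReal.ofReal_add (by positivity) (by positivity),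
            ENNReal.ofReal_mul (p := 2 ^ n + 1) (by positivity),
            ENNReal.ofReal_add (p := 2 ^ n) (by positivity) zero_le_one,
            ENNReal.ofReal_pow zero_le_two]
          norm_num
        have e1 := hF2 n u
        push_cast at e1
        calc volume.real (M ∩ (fun s => s - u) ⁻¹' Mᶜ) * ‖𝓕 (f n : ℝ → ℂ) u‖
            ≤ ((2 ^ n + 1) * |u| + 2 * (1 / 2) ^ 3 ^ n * (1 / 2) ^ n) *
                ‖𝓕 (f n : ℝ → ℂ) u‖ := mul_le_mul_of_nonneg_right hle (norm_nonneg _)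
          _ = (2 ^ n + 1) * (|u| * ‖𝓕 (f n : ℝ → ℂ) u‖) +
                2 * (1 / 2) ^ 3 ^ n * (1 / 2) ^ n * ‖𝓕 (f n : ℝ → ℂ) u‖ := by ring
          _ ≤ (2 ^ n + 1) * (D / 3 ^ n) +
                2 * (1 / 2) ^ 3 ^ n * (1 / 2) ^ n * (D * R * 2 ^ 3 ^ n) :=
              add_le_add (mul_le_mul_of_nonneg_left e1 (by positivity))
                (mul_le_mul_of_nonneg_left (hF1 n u) (by positivity))
          _ = b n := by
              have : (1 / 2 : ℝ) ^ 3 ^ n * 2 ^ 3 ^ n = 1 := by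
                rw [← mul_pow]
                norm_num
              simp only [b]
              linear_combination (2 * (1 / 2) ^ n * (D * R)) * this
    exact ⟨h1, h2.trans (mul_le_mul_of_nonneg_left (hF3 n) hbn)⟩
  obtain ⟨N, hN⟩ := Filter.eventually_atTop.1 hvar
  have hint : ∀ n, Integrable (fun X => ‖S (n + N) X‖ ^ 2) P := fun n =>
    (hN _ (Nat.le_add_left N n)).1
  have hL1 : Filter.Tendsto
      (fun n => eLpNorm ((fun X => ‖S (n + N) X‖ ^ 2) - fun _ => (0 : ℝ)) 1 P)
      Filter.atTop (nhds 0) := by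
    have hb' := (ENNReal.continuous_ofReal.tendsto _).comp (hb.comp (Filter.tendsto_add_atTop_nat N))
    rw [ENNReal.ofReal_zero] at hb'
    refine tendsto_of_tendsto_of_tendsto_of_le_of_le tendsto_const_nhds hb' (fun _ => zero_le)
      fun n => ?_
    have hz : ((fun X => ‖S (n + N) X‖ ^ 2) - fun _ => (0 : ℝ)) = fun X => ‖S (n + N) X‖ ^ 2 := by
      ext X
      simp
    simp only [hz]
    rw [eLpNorm_one_eq_lintegral_enorm, ← ofReal_integral_norm_eq_lintegral_enorm (hint n)]
    refine ENNReal.ofReal_le_ofReal (le_trans (le_of_eq ?_) (hN _ (Nat.le_add_left N n)).2)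
    simp
  -- L¹ convergence of the squares gives convergence in measure, hence almost surely along a
  -- subsequence.
  obtain ⟨ns, -, hns⟩ := (tendstoInMeasure_of_tendsto_eLpNorm one_ne_zero
    (fun n => (hint n).aestronglyMeasurable) aestronglyMeasurable_const
    hL1).exists_seq_tendsto_ae
  refine ⟨fun j => g (ns j + N), fun j => volume.real M * ∫ x, g (ns j + N) x, fun j =>
    ⟨(hgc _).measurable, hg0 _, hg _, fun x hx => hg1 _ x ?_⟩, ?_⟩
  · simpa using hBR hx
  · filter_upwards [hns] with X hX
    rw [tendsto_zero_iff_norm_tendsto_zero]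
    have := (Real.continuous_sqrt.tendsto 0).comp hX
    rw [Real.sqrt_zero] at this
    exact this.congr fun j => Real.sqrt_sq (norm_nonneg _)

theorem theorem1p1 (α : ℕ → ℝ) (hα : ∀ n, 1 ≤ n → 0 < α n ∧ α n < 1)
    (hl : ∃ δ : ℝ, 0 < δ ∧ δ < 1 ∧
      Summable fun n : ℕ =>
        gapLength α (n + 1) ^ ((1 : ℝ) / (4 : ℝ) ^ (((n + 1 : ℕ) : ℝ) / δ))) :
    (∀ P : Measure (Conf ℝ), IsProbabilityMeasure P →
      IsDeterminantal (fourierKernel (genCantorSet α)) volume P → IsNumberRigid P) ∧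
    (∀ P : Measure (Conf ℝ), IsProbabilityMeasure P →
      IsDeterminantal (fourierKernel (Icc 0 1 \ genCantorSet α)) volume P → IsNumberRigid P) := by
  obtain ⟨δ, h0, h1, hs⟩ := hl
  have htail := eventually_tsum_gapLength_le (eventually_gapLength_le hα h0 h1 hs)
  have hI : volume (Icc (0 : ℝ) 1) ≠ ∞ := measure_Icc_lt_top.ne
  refine ⟨fun P _ hP => isNumberRigid_of_translateDefect_le measurableSet_genCantorSet
    (measure_ne_top_of_subset genCantorSet_subset_Icc hI) ?_ hP,
    fun P _ hP => isNumberRigid_of_translateDefect_le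
    (measurableSet_Icc.diff measurableSet_genCantorSet)
    (measure_ne_top_of_subset sdiff_subset hI) ?_ hP⟩
  · filter_upwards [htail] with n hn u
    refine (translateDefect_genCantorSet_le hα n u).trans (add_le_add ?_ hn)
    gcongr
    exact le_self_add
  -- Here the extra |u| in the coefficient 2^n + 1 is used, for the points pushed out of [0, 1].
  · filter_upwards [htail] with n hn u
    refine (translateDefect_Icc_diff_le _ u).trans ?_
    have := (translateDefect_genCantorSet_le hα n (-u)).trans (add_le_add le_rfl hn)
    rw [abs_neg] at this
    refine (add_le_add le_rfl this).trans_eq ?_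
    ring
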